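/- **Notation.** Let $\mathbb N=\{1,2,3,\dots\}$. A sequence $Y=(a_1,a_2,\dots)\in\mathbb N^\infty$ represents the irrational number $x_Y=\cfrac{1}{a_1+\cfrac{1}{a_2+\cdots}}\in(0,1)$. For $v\in\mathbb N^*$ let $\gamma(C_v)$ be the Gauss measure (density $\frac{1}{\ln 2\,(1+x)}$ on $(0,1)$) of the set of all $x_Y$ such that $Y$ begins with $v$. For $w\in\{0,1\}^*$ let $\mu(C_w)=2^{-|w|}$ be the Lebesgue measure of the set of reals in $[0,1]$ having a binary expansion that begins with $w$. For $s\in[0,\infty)$, a *continued fraction $s$-gale* is a function $d:\mathbb N^*\to[0,\infty)$ with $d(v)\,\gamma(C_v)^s=\sum_{i\in\mathbb N}d(vi)\,\gamma(C_{vi})^s$ for all $v\in\mathbb N^*$; a *binary $s$-gale* is a function $d:\{0,1\}^*\to[0,\infty)$ with $d(w)\,\mu(C_w)^s=\sum_{i\in\{0,1\}}d(wi)\,\mu(C_{wi})^s$ for all $w\in\{0,1\}^*$. A gale $d$ *succeeds* on an infinite sequence $Z$ if $\limsup_{n\to\infty}d(Z\restriction n)=\infty$, where $Z\restriction n$ is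 the word of the first $n$ entries of $Z$. It is *lower semicomputable* if there is a total computable function $\hat d$ with values in $\mathbb Q\cap[0,\infty)$ such that, for all words $w$ and all $n$, $\hat d(w,n)\le\hat d(w,n+1)\le d(w)$, and $\lim_{n\to\infty}\hat d(w,n)=d(w)$. The *effective continued fraction dimension* $\mathrm{cdim}_{CF}(Y)$ of $Y\in\mathbb N^\infty$ is the infimum of all $s\in[0,\infty)$ for which some lower semicomputable continued fraction $s$-gale succeeds on $Y$. The *constructive (effective Hausdorff) dimension* $\mathrm{cdim}(Y)$ is the infimum of all $s\in[0,\infty)$ for which some lower semicomputable binary $s$-gale succeeds on the binary expansion of $x_Y$. **Theorem.** For every real $\varepsilon$ with $0<\varepsilon<0.5$ there exists $Y\in\mathbb N^\infty$ such that $$\mathrm{cdim}_{CF}(Y)\ \ge\ 0.5\qquad\text{and}\qquad \mathrm{cdim}(Y)\ \le\ \varepsilon .$$ -/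

import Mathlib

open MeasureTheory Filter Topology Set
open scoped NNReal ENNReal

namespace CFDim

/-! ### Words, sequences, cylinders, success sets

Finite words over `A` are lists, infinite sequences are functions `ℕ → A`.
The alphabet is `Fin 2` for binary sequences and `ℕ+` for continued fractions. -/

section Words

variable {A : Type}

/-- The word formed by the first `n` entries of the sequence `Y`. -/
def pre (Y : ℕ → A) (n : ℕ) : List A := (List.range n).map Y

/-- The cylinder of `w`: all infinite sequences that begin with `w`. -/
def cylinder (w : List A) : Set (ℕ → A) := {Y | pre Y w.length = w}

/-- `d` is an `s`-gale with respect to the cylinder measure `m`: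
`d(w) m(C_w)^s = ∑ a, d(wa) m(C_{wa})^s` for every word `w`.
The values of `d` are finite; the sum is taken in `[0, ∞]`. -/
def IsGale (m : List A → ℝ≥0∞) (s : ℝ≥0) (d : List A → ℝ≥0) : Prop :=
  ∀ w : List A,
    (d w : ℝ≥0∞) * m w ^ (s : ℝ) = ∑' a : A, (d (w ++ [a]) : ℝ≥0∞) * m (w ++ [a]) ^ (s : ℝ)

/-- The success set of `d`: the sequences along which the upper limit of `d` is `∞`. -/
def successSet (d : List A → ℝ≥0) : Set (ℕ → A) :=
  {Y | limsup (fun n : ℕ => (d (pre Y n) : ℝ≥0∞)) atTop = ∞}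

end Words

/-! ### Lower semicomputability -/

instance primcodablePNat : Primcodable ℕ+ := Primcodable.ofEquiv ℕ Equiv.pnatEquivNat

/-- A total function with values in the nonnegative rationals is computable if
numerators and (nonzero) denominators of its values can be computed. -/
def ComputableNNRat {α : Type} [Primcodable α] (f : α → ℚ≥0) : Prop :=
  ∃ num den : α → ℕ, Computable num ∧ Computable den ∧
    ∀ x, den x ≠ 0 ∧ f x = (num x : ℚ≥0) / (den x : ℚ≥0)

/-- `d` is the pointwise limit, from below and monotonically, of a computable
function `dhat (w, n)` with nonnegative rational values. -/
def LowerSemicomputable {α : Type} [Primcodable α] (d : α → ℝ≥0) : Prop :=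
  ∃ dhat : α × ℕ → ℚ≥0, ComputableNNRat dhat ∧
    (∀ w n, dhat (w, n) ≤ dhat (w, n + 1) ∧ ((dhat (w, n + 1) : ℚ≥0) : ℝ≥0) ≤ d w) ∧
    ∀ w, Tendsto (fun n : ℕ => ((dhat (w, n) : ℚ≥0) : ℝ≥0)) atTop (𝓝 (d w))

/-- The infimum (in `[0, ∞]`) of all `s ≥ 0` for which some lower semicomputable `s`-gale with
respect to `m` succeeds on every element of `F`. -/
noncomputable def galeDim {A : Type} [Primcodable A] (m : List A → ℝ≥0∞) (F : Set (ℕ → A)) : ℝ≥0∞ :=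
  sInf {t : ℝ≥0∞ | ∃ s : ℝ≥0, t = (s : ℝ≥0∞) ∧
    ∃ d : List A → ℝ≥0, IsGale m s d ∧ LowerSemicomputable d ∧ F ⊆ successSet d}

/-! ### Binary sequences -/

/-- Lebesgue measure of the set of reals with a binary expansion in the cylinder of `w`. -/
noncomputable def binMeasure (w : List (Fin 2)) : ℝ≥0∞ :=
  volume (Real.ofDigits '' cylinder w)

/-- Constructive (effective Hausdorff) dimension of a set of binary sequences. -/
noncomputable def cdimBin (F : Set (ℕ → Fin 2)) : ℝ≥0∞ := galeDim binMeasure F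

/-! ### Continued fractions -/

/-- The infinite continued fraction `[Y 0, Y 1, …] = 1 / (Y 0 + 1 / (Y 1 + ⋯))`. -/
noncomputable def contFract (Y : ℕ → ℕ+) : GenContFract ℝ :=
  ⟨0, Stream'.Seq.ofStream fun n => ⟨1, ((Y n : ℕ) : ℝ)⟩⟩

/-- The real number represented by `Y`, the limit of the convergents
(which exists for every sequence of positive integers). -/
noncomputable def cfValue (Y : ℕ → ℕ+) : ℝ := limUnder atTop (contFract Y).convs

/-- The Gauss measure on the unit interval, with density `1 / (ln 2 * (1 + x))`. -/
noncomputable def gaussMeasure : Measure ℝ :=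
  (volume.restrict (Ioo (0 : ℝ) 1)).withDensity
    fun x => ENNReal.ofReal (1 / (Real.log 2 * (1 + x)))

/-- Gauss measure of the set of reals whose continued fraction lies in the cylinder of `v`. -/
noncomputable def cfMeasure (v : List ℕ+) : ℝ≥0∞ := gaussMeasure (cfValue '' cylinder v)

/-- Effective continued fraction dimension of a set of continued fractions. -/
noncomputable def cdimCFSet (F : Set (ℕ → ℕ+)) : ℝ≥0∞ := galeDim cfMeasure F

/-- Effective continued fraction dimension of the point `Y`. -/
noncomputable def cdimCF (Y : ℕ → ℕ+) : ℝ≥0∞ := cdimCFSet {Y}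

/-- Constructive dimension of the real number represented by `Y`,
i.e. of its sequence of binary digits. -/
noncomputable def cdim (Y : ℕ → ℕ+) : ℝ≥0∞ := cdimBin {Real.digits (cfValue Y) 2}

end CFDim

/-! Two effects are combined. For a fixed word `v`, the cylinder of `vi` has Gauss measure at least
a constant times `1/i²` (`exists_le_cfMeasure`), so for `s ≤ 1/2` its `s`-th power is at least a
constant times `1/i`. The gale identity makes `∑ d(vi) γ(C_{vi})^s` finite, hence the letters on
which `d` grows have finite sum of reciprocals (`IsGale.tsum_growthSet_ne_top`). The harmonic series
diverges, so finitely many gales can be kept from growing by arbitrarily large letters. There are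
only countably many lower semicomputable gales, and a diagonal construction leaves each of them
bounded along `Y` (`exists_sequence_defeating_gales`).

The freedom to take huge letters makes `x_Y` so close to its convergents that long binary prefixes
agree with those of rationals with small codes. A binary gale that splits its capital over all
rationals succeeds at any exponent `s = log₂(1 + 1/k)` (`exists_growth_cdim_le`). -/

namespace CFDim

/-! ### Prefixes -/

section Words

variable {A : Type}

@[simp] lemma pre_zero (Y : ℕ → A) : pre Y 0 = [] := rfl

@[simp] lemma length_pre (Y : ℕ → A) (n : ℕ) : (pre Y n).length = n := by simp [pre]

lemma pre_succ (Y : ℕ → A) (n : ℕ) : pre Y (n + 1) = pre Y n ++ [Y n] := by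
  simp [pre, List.range_succ]

lemma pre_succ' (Y : ℕ → A) (n : ℕ) : pre Y (n + 1) = Y 0 :: pre (fun k => Y (k + 1)) n := by
  simp [pre, List.range_succ_eq_map, Function.comp_def]

lemma pre_congr {Y Z : ℕ → A} {n : ℕ} (h : ∀ i < n, Y i = Z i) : pre Y n = pre Z n := by
  simpa [pre] using h

end Words

/-! ### The Möbius maps of continued fractions -/

/-- The map `t ↦ 1 / (v₀ + 1 / (v₁ + ⋯ + 1 / (vₙ₋₁ + t)))`. -/
noncomputable def cfMap : List ℕ+ → ℝ → ℝ
  | [], t => t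
  | a :: v, t => 1 / (((a : ℕ) : ℝ) + cfMap v t)

lemma one_le_pnat_cast (a : ℕ+) : (1 : ℝ) ≤ ((a : ℕ) : ℝ) := by exact_mod_cast one_le

lemma one_div_add_mem (a : ℕ+) {t : ℝ} (ht : t ∈ Icc (0 : ℝ) 1) :
    1 / (((a : ℕ) : ℝ) + t) ∈ Icc (0 : ℝ) 1 := by
  have := one_le_pnat_cast a
  have := ht.1
  refine ⟨by positivity, ?_⟩
  rw [div_le_one (by linarith)]
  linarith

lemma cfMap_mem (v : List ℕ+) {t : ℝ} (ht : t ∈ Icc (0 : ℝ) 1) : cfMap v t ∈ Icc (0 : ℝ) 1 := by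
  induction v with
  | nil => exact ht
  | cons a v ih => exact one_div_add_mem a ih

lemma cfMap_append (v w : List ℕ+) (t : ℝ) : cfMap (v ++ w) t = cfMap v (cfMap w t) := by
  induction v with
  | nil => rfl
  | cons a v ih => simp [cfMap, ih]

lemma abs_one_div_add_sub_le (a : ℕ+) {t u : ℝ} (ht : 0 ≤ t) (hu : 0 ≤ u) :
    |1 / (((a : ℕ) : ℝ) + t) - 1 / (((a : ℕ) : ℝ) + u)| ≤ |t - u| := by
  have h := one_le_pnat_cast a
  have h1 : 1 / (((a : ℕ) : ℝ) + t) - 1 / (((a : ℕ) : ℝ) + u)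
      = (u - t) / ((((a : ℕ) : ℝ) + t) * (((a : ℕ) : ℝ) + u)) := by
    field_simp
    ring
  rw [h1, abs_div, abs_sub_comm]
  refine div_le_self (abs_nonneg _) ?_
  rw [abs_of_nonneg (by positivity)]
  nlinarith

lemma one_div_add_one_div_add_sub (a b : ℕ+) {t u : ℝ} (ht : 0 ≤ t) (hu : 0 ≤ u) :
    1 / (((a : ℕ) : ℝ) + 1 / (((b : ℕ) : ℝ) + t)) - 1 / (((a : ℕ) : ℝ) + 1 / (((b : ℕ) : ℝ) + u))
      = (t - u) / ((((a : ℕ) : ℝ) * (((b : ℕ) : ℝ) + t) + 1)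
          * (((a : ℕ) : ℝ) * (((b : ℕ) : ℝ) + u) + 1)) := by
  have ha := one_le_pnat_cast a
  have hb := one_le_pnat_cast b
  field_simp
  ring

lemma two_le_mul_add_one (a b : ℕ+) {t : ℝ} (ht : 0 ≤ t) :
    2 ≤ ((a : ℕ) : ℝ) * (((b : ℕ) : ℝ) + t) + 1 := by
  have ha := one_le_pnat_cast a
  have hb := one_le_pnat_cast b
  nlinarith

/-- The letter 1 alone has derivative of modulus 1 at 0, so contraction comes from pairs of letters,
by a factor 4 each. The prefactor 2 absorbs an unpaired last letter. -/
lemma abs_cfMap_sub_le : ∀ (v : List ℕ+) {t u : ℝ}, t ∈ Icc (0 : ℝ) 1 → u ∈ Icc (0 : ℝ) 1 →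
    |cfMap v t - cfMap v u| ≤ 2 * (1 / 2) ^ v.length * |t - u|
  | [], t, u, _, _ => by
    simp only [cfMap, List.length_nil, pow_zero]
    nlinarith [abs_nonneg (t - u)]
  | [a], t, u, ht, hu => by
    simpa [cfMap] using abs_one_div_add_sub_le a ht.1 hu.1
  | a :: b :: v, t, u, ht, hu => by
    have ih := abs_cfMap_sub_le v ht hu
    have h1 := cfMap_mem v ht
    have h2 := cfMap_mem v hu
    simp only [cfMap, List.length_cons]
    rw [one_div_add_one_div_add_sub a b h1.1 h2.1, abs_div]
    have h3 := two_le_mul_add_one a b h1.1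
    have h4 := two_le_mul_add_one a b h2.1
    have h5 := mul_le_mul h3 h4 zero_le_two (by linarith)
    rw [abs_of_nonneg (by linarith : 0 ≤ (((a : ℕ) : ℝ) * (((b : ℕ) : ℝ) + cfMap v t) + 1)
          * (((a : ℕ) : ℝ) * (((b : ℕ) : ℝ) + cfMap v u) + 1))]
    refine (div_le_div_of_nonneg_left (abs_nonneg _) (by norm_num) h5).trans ?_
    rw [pow_succ, pow_succ]
    linarith

/-- For words of even length, `cfMap v` is increasing and does not expand distances. -/
lemma cfMap_sub_of_even : ∀ (v : List ℕ+), Even v.length → ∀ {t : ℝ}, t ∈ Ioc (0 : ℝ) 1 →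
    0 < cfMap v t - cfMap v 0 ∧ cfMap v t - cfMap v 0 ≤ t
  | [], _, t, ht => by simpa [cfMap] using ht.1
  | [a], h, _, _ => by simp at h
  | a :: b :: v, h, t, ht => by
    have ih := cfMap_sub_of_even v (by simpa [Nat.even_add_one] using h) ht
    have h1 := cfMap_mem v ⟨ht.1.le, ht.2⟩
    have h2 := cfMap_mem v (t := 0) (by simp)
    simp only [cfMap]
    rw [one_div_add_one_div_add_sub a b h1.1 h2.1]
    have h3 := two_le_mul_add_one a b h1.1
    have h4 := two_le_mul_add_one a b h2.1
    refine ⟨div_pos ih.1 (by positivity), (div_le_self ih.1.le ?_).trans ih.2⟩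
    nlinarith

lemma cfMap_zero_rat (v : List ℕ+) : ∃ a b : ℕ, 0 < b ∧ cfMap v 0 = (a : ℝ) / b := by
  induction v with
  | nil => exact ⟨0, 1, one_pos, by simp [cfMap]⟩
  | cons c v ih =>
    obtain ⟨a, b, hb, h⟩ := ih
    refine ⟨b, c * b + a, by positivity, ?_⟩
    have : (0 : ℝ) < b := by exact_mod_cast hb
    have := one_le_pnat_cast c
    simp only [cfMap, h]
    push_cast
    field_simp

/-! ### Convergence of continued fractions -/

lemma contFract_convs (Y : ℕ → ℕ+) (n : ℕ) : (contFract Y).convs n = cfMap (pre Y n) 0 := by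
  have hget : ∀ m, (contFract Y).s.get? m = some ⟨1, ((Y m : ℕ) : ℝ)⟩ := fun m => rfl
  rw [GenContFract.convs_eq_convs']
  · have key : ∀ (n : ℕ) (Y : ℕ → ℕ+), GenContFract.convs'Aux (contFract Y).s n
        = cfMap (pre Y n) 0 := by
      intro n
      induction n with
      | zero => intro Y; rfl
      | succ n ih =>
        intro Y
        have htail : (contFract Y).s.tail = (contFract fun k => Y (k + 1)).s := by
          ext1 m
          rfl
        rw [GenContFract.convs'Aux_succ_some (p := ⟨1, ((Y 0 : ℕ) : ℝ)⟩) rfl, htail, ih, pre_succ']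
        rfl
    rw [GenContFract.convs', key]
    simp [contFract]
  · intro gp m _ h
    rw [hget] at h
    cases h
    exact ⟨one_pos, by positivity⟩

lemma cauchySeq_cfMap (Y : ℕ → ℕ+) : CauchySeq fun n => cfMap (pre Y n) 0 := by
  refine cauchySeq_of_le_geometric (1 / 2) 2 (by norm_num) fun n => ?_
  rw [pre_succ, cfMap_append, Real.dist_eq]
  have h0 : (0 : ℝ) ∈ Icc (0 : ℝ) 1 := by simp
  have h1 := cfMap_mem [Y n] h0
  refine (abs_cfMap_sub_le _ h0 h1).trans ?_
  rw [length_pre]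
  refine mul_le_of_le_one_right (by positivity) ?_
  rw [abs_le]
  constructor <;> linarith [h1.1, h1.2]

lemma tendsto_cfMap (Y : ℕ → ℕ+) :
    Tendsto (fun n => cfMap (pre Y n) 0) atTop (𝓝 (cfValue Y)) := by
  have h : (contFract Y).convs = fun n => cfMap (pre Y n) 0 := funext (contFract_convs Y)
  rw [cfValue, h]
  exact (cauchySeq_cfMap Y).tendsto_limUnder

lemma cfValue_mem_Icc (Y : ℕ → ℕ+) : cfValue Y ∈ Icc (0 : ℝ) 1 :=
  isClosed_Icc.mem_of_tendsto (tendsto_cfMap Y)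
    (Eventually.of_forall fun _ => cfMap_mem _ (by simp))

lemma cfValue_eq_one_div (Y : ℕ → ℕ+) :
    cfValue Y = 1 / (((Y 0 : ℕ) : ℝ) + cfValue fun k => Y (k + 1)) := by
  have h1 := (tendsto_cfMap Y).comp (tendsto_add_atTop_nat 1)
  have h2 := (tendsto_cfMap fun k => Y (k + 1)).const_add ((Y 0 : ℕ) : ℝ)
  have h3 := (tendsto_const_nhds (x := (1 : ℝ))).div h2 (by
    have := one_le_pnat_cast (Y 0)
    have := (cfValue_mem_Icc fun k => Y (k + 1)).1
    positivity)
  refine tendsto_nhds_unique h1 (h3.congr fun n => ?_)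
  simp [pre_succ', cfMap]

lemma cfValue_pos (Y : ℕ → ℕ+) : 0 < cfValue Y := by
  rw [cfValue_eq_one_div]
  have := one_le_pnat_cast (Y 0)
  have := (cfValue_mem_Icc fun k => Y (k + 1)).1
  positivity

lemma cfValue_lt_one_div (Y : ℕ → ℕ+) : cfValue Y < 1 / ((Y 0 : ℕ) : ℝ) := by
  rw [cfValue_eq_one_div]
  have := one_le_pnat_cast (Y 0)
  have := cfValue_pos fun k => Y (k + 1)
  exact one_div_lt_one_div_of_lt (by linarith) (by linarith)

lemma cfValue_lt_one (Y : ℕ → ℕ+) : cfValue Y < 1 := by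
  refine (cfValue_lt_one_div Y).trans_le ?_
  have := one_le_pnat_cast (Y 0)
  rw [div_le_one (by linarith)]
  exact this

lemma cfValue_eq_cfMap (n : ℕ) : ∀ Y : ℕ → ℕ+,
    cfValue Y = cfMap (pre Y n) (cfValue fun k => Y (k + n)) := by
  induction n with
  | zero => intro Y; rfl
  | succ n ih =>
    intro Y
    rw [pre_succ', cfValue_eq_one_div, ih]
    simp [cfMap, add_assoc]

/-- A sequence of complete quotients determines the value of the continued fraction. -/
lemma cfValue_eq_of_quotients (Y : ℕ → ℕ+) (x : ℕ → ℝ) (hx : ∀ n, x n ∈ Icc (0 : ℝ) 1)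
    (h : ∀ n, x n = 1 / (((Y n : ℕ) : ℝ) + x (n + 1))) : cfValue Y = x 0 := by
  have key : ∀ n, x 0 = cfMap (pre Y n) (x n) := by
    intro n
    induction n with
    | zero => rfl
    | succ n ih => rw [pre_succ, cfMap_append, ih, h n]; rfl
  refine tendsto_nhds_unique (tendsto_cfMap Y) ?_
  rw [tendsto_iff_dist_tendsto_zero]
  refine squeeze_zero (g := fun n : ℕ => 2 * (1 / 2 : ℝ) ^ n) (fun _ => dist_nonneg) (fun n => ?_) ?_
  · rw [key n, Real.dist_eq]
    refine (abs_cfMap_sub_le _ (by simp) (hx n)).trans ?_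
    rw [length_pre]
    refine mul_le_of_le_one_right (by positivity) ?_
    rw [abs_le]
    constructor <;> linarith [(hx n).1, (hx n).2]
  · simpa using (tendsto_pow_atTop_nhds_zero_of_lt_one (r := (1 / 2 : ℝ)) (by norm_num)
      (by norm_num)).const_mul 2

/-- The complete quotients are the orbit of `x` under the Gauss map `t ↦ fract (1/t)`. Irrationality
keeps the orbit inside the open interval, so all letters are positive. -/
lemma exists_cfValue_eq {x : ℝ} (hx : Irrational x) (hx' : x ∈ Ioo (0 : ℝ) 1) :
    ∃ Y, cfValue Y = x := by
  let f : ℕ → ℝ := fun n => (fun t : ℝ => Int.fract (1 / t))^[n] x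
  have hf : ∀ n, f (n + 1) = Int.fract (1 / f n) := fun n => Function.iterate_succ_apply' _ _ _
  have hmem : ∀ n, Irrational (f n) ∧ f n ∈ Ioo (0 : ℝ) 1 := by
    intro n
    induction n with
    | zero => exact ⟨hx, hx'⟩
    | succ n ih =>
      rw [hf]
      have h1 : Irrational (Int.fract (1 / f n)) := by
        rw [Int.fract, one_div]
        exact ih.1.inv.sub_intCast _
      exact ⟨h1, lt_of_le_of_ne (Int.fract_nonneg _) h1.ne_zero.symm, Int.fract_lt_one _⟩
  have hfl : ∀ n, 0 < ⌊1 / f n⌋₊ := by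
    intro n
    rw [Nat.floor_pos, le_div_iff₀ (hmem n).2.1]
    linarith [(hmem n).2.2]
  refine ⟨fun n => ⟨⌊1 / f n⌋₊, hfl n⟩, ?_⟩
  refine cfValue_eq_of_quotients _ f (fun n => Ioo_subset_Icc_self (hmem n).2) fun n => ?_
  have hpos := (hmem n).2.1
  have h2 : ((⌊1 / f n⌋₊ : ℕ) : ℝ) + f (n + 1) = 1 / f n := by
    rw [hf, ← Int.self_sub_floor, natCast_floor_eq_intCast_floor (by positivity)]
    ring
  simp only [PNat.mk_coe]
  rw [h2, one_div_one_div]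

/-! ### Measures of continued fraction cylinders -/

lemma image_cylinder_cons (a : ℕ+) (v : List ℕ+) :
    (fun t : ℝ => 1 / (((a : ℕ) : ℝ) + t)) '' (cfValue '' cylinder v)
      ⊆ cfValue '' cylinder (a :: v) := by
  rintro _ ⟨_, ⟨Y, hY, rfl⟩, rfl⟩
  refine ⟨fun n => Nat.casesOn n a Y, ?_, ?_⟩
  · have : pre Y v.length = v := hY
    simp [cylinder, pre_succ', this]
  · exact cfValue_eq_one_div _

lemma image_cylinder_subset (v : List ℕ+) : cfValue '' cylinder v ⊆ Ioo 0 1 := by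
  rintro _ ⟨Y, -, rfl⟩
  exact ⟨cfValue_pos Y, cfValue_lt_one Y⟩

/-- The inverse map `u ↦ 1/u - a` is Lipschitz with constant `(a+1)²` on the image. Arguing through
Hausdorff measure needs no measurability of `S`. -/
lemma volume_le_volume_image_one_div_add (a : ℕ+) {S : Set ℝ} (hS : S ⊆ Ioo 0 1) :
    ENNReal.ofReal ((1 / (((a : ℕ) : ℝ) + 1)) ^ 2) * volume S
      ≤ volume ((fun t : ℝ => 1 / (((a : ℕ) : ℝ) + t)) '' S) := by
  set g : ℝ → ℝ := fun t => 1 / (((a : ℕ) : ℝ) + t) with hg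
  have ha := one_le_pnat_cast a
  have hlip : LipschitzOnWith ((((a : ℕ) : ℝ≥0) + 1) ^ 2)
      (fun u : ℝ => 1 / u - ((a : ℕ) : ℝ)) (g '' S) := by
    refine LipschitzOnWith.of_dist_le_mul ?_
    rintro _ ⟨t, ht, rfl⟩ _ ⟨u, hu, rfl⟩
    have ht := hS ht
    have hu := hS hu
    have ht0 := ht.1
    have hu0 := hu.1
    have h1 : g t - g u = (u - t) / ((((a : ℕ) : ℝ) + t) * (((a : ℕ) : ℝ) + u)) := by
      simp only [hg]
      field_simp
      ring
    rw [Real.dist_eq, Real.dist_eq, h1, abs_div,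
      abs_of_pos (by positivity : 0 < (((a : ℕ) : ℝ) + t) * (((a : ℕ) : ℝ) + u)),
      mul_div_assoc', le_div_iff₀ (by positivity)]
    simp only [hg, one_div_one_div]
    push_cast
    rw [show (((a : ℕ) : ℝ) + t - ((a : ℕ) : ℝ) - (((a : ℕ) : ℝ) + u - ((a : ℕ) : ℝ)) : ℝ) = t - u
      by ring, abs_sub_comm u t, mul_comm]
    refine mul_le_mul_of_nonneg_right ?_ (abs_nonneg _)
    rw [pow_two]
    exact mul_le_mul (by linarith [ht.2]) (by linarith [hu.2]) (by linarith) (by linarith)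
  have himg : (fun u : ℝ => 1 / u - ((a : ℕ) : ℝ)) '' (g '' S) = S := by
    rw [image_image]
    simp [hg]
  have h := hlip.hausdorffMeasure_image_le zero_le_one
  rw [himg, hausdorffMeasure_real, ENNReal.rpow_one] at h
  refine (mul_le_mul_right h _).trans ?_
  rw [← mul_assoc]
  refine mul_le_of_le_one_left zero_le ?_
  rw [← ENNReal.ofReal_coe_nnreal, ← ENNReal.ofReal_mul (by positivity), ENNReal.ofReal_le_one]
  push_cast
  rw [← mul_pow, one_div, inv_mul_cancel₀ (by positivity), one_pow]

lemma volume_image_cylinder_nil : 1 ≤ volume (cfValue '' cylinder []) := by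
  have h : Ioo (0 : ℝ) 1 \ range ((↑) : ℚ → ℝ) ⊆ cfValue '' cylinder [] := by
    rintro x ⟨hx, hx'⟩
    obtain ⟨Y, hY⟩ := exists_cfValue_eq hx' hx
    exact ⟨Y, by simp [cylinder], hY⟩
  refine le_trans ?_ (measure_mono h)
  rw [measure_sdiff_null ((countable_range _).measure_zero _)]
  simp

/-- Letters are peeled off the front, each costing a factor that depends on that letter only; thus
`c` is independent of the last letter `i`. -/
lemma exists_le_volume_image_cylinder (v : List ℕ+) : ∃ c : ℝ, 0 < c ∧ ∀ i : ℕ+,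
    ENNReal.ofReal ((c / (i : ℕ)) ^ 2) ≤ volume (cfValue '' cylinder (v ++ [i])) := by
  induction v with
  | nil =>
    refine ⟨1 / 2, by norm_num, fun i => ?_⟩
    have hi := one_le_pnat_cast i
    refine le_trans ?_ (measure_mono (image_cylinder_cons i []))
    refine le_trans ?_ (volume_le_volume_image_one_div_add i (image_cylinder_subset []))
    refine le_trans ?_ (mul_le_mul_right volume_image_cylinder_nil _)
    rw [mul_one]
    refine ENNReal.ofReal_le_ofReal (pow_le_pow_left₀ (by positivity) ?_ 2)
    rw [div_div]
    exact one_div_le_one_div_of_le (by positivity) (by linarith)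
  | cons a v ih =>
    obtain ⟨c, hc, h⟩ := ih
    refine ⟨1 / (((a : ℕ) : ℝ) + 1) * c, by positivity, fun i => ?_⟩
    refine le_trans ?_ (measure_mono (image_cylinder_cons a (v ++ [i])))
    refine le_trans ?_ (volume_le_volume_image_one_div_add a (image_cylinder_subset _))
    refine le_trans ?_ (mul_le_mul_right (h i) _)
    rw [← ENNReal.ofReal_mul (by positivity), ← mul_pow, mul_div_assoc]

lemma volume_le_gaussMeasure {S : Set ℝ} (hS : S ⊆ Ioo 0 1) :
    ENNReal.ofReal (1 / (Real.log 2 * 2)) * volume S ≤ gaussMeasure S := by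
  have hlog := Real.log_pos one_lt_two
  have h1 : (volume.restrict (Ioo (0 : ℝ) 1)).withDensity
      (fun _ => ENNReal.ofReal (1 / (Real.log 2 * 2))) ≤ gaussMeasure := by
    refine withDensity_mono ?_
    filter_upwards [ae_restrict_mem measurableSet_Ioo] with x hx
    refine ENNReal.ofReal_le_ofReal (one_div_le_one_div_of_le ?_ ?_)
    · have := hx.1
      positivity
    · exact mul_le_mul_of_nonneg_left (by linarith [hx.2]) hlog.le
  have h2 := h1 S
  rwa [withDensity_const, Measure.smul_apply, Measure.restrict_apply' measurableSet_Ioo,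
    inter_eq_left.2 hS, smul_eq_mul] at h2

lemma exists_le_cfMeasure (v : List ℕ+) : ∃ c : ℝ, 0 < c ∧ ∀ i : ℕ+,
    ENNReal.ofReal ((c / (i : ℕ)) ^ 2) ≤ cfMeasure (v ++ [i]) := by
  obtain ⟨c, hc, h⟩ := exists_le_volume_image_cylinder v
  have hlog := Real.log_pos one_lt_two
  refine ⟨√(1 / (Real.log 2 * 2)) * c, by positivity, fun i => ?_⟩
  refine le_trans ?_ (volume_le_gaussMeasure (image_cylinder_subset _))
  refine le_trans ?_ (mul_le_mul_right (h i) _)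
  rw [← ENNReal.ofReal_mul (by positivity), mul_div_assoc, mul_pow, Real.sq_sqrt (by positivity)]

lemma cfMeasure_ne_top (v : List ℕ+) : cfMeasure v ≠ ∞ := by
  have hlog := Real.log_pos one_lt_two
  have h1 : gaussMeasure ≤ (volume.restrict (Ioo (0 : ℝ) 1)).withDensity
      (fun _ => ENNReal.ofReal (1 / Real.log 2)) := by
    refine withDensity_mono ?_
    filter_upwards [ae_restrict_mem measurableSet_Ioo] with x hx
    refine ENNReal.ofReal_le_ofReal (one_div_le_one_div_of_le hlog ?_)
    nlinarith [hx.1]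
  refine ((h1 _).trans_lt ?_).ne
  rw [withDensity_const, Measure.smul_apply, smul_eq_mul]
  exact ENNReal.mul_lt_top ENNReal.ofReal_lt_top (measure_lt_top _ _)

/-! ### Letters along which a continued fraction gale grows -/

/-- The letters `i` for which `d` grows on passing from `v` to `vi` (ignoring values below `1`). -/
def growthSet (d : List ℕ+ → ℝ≥0) (v : List ℕ+) : Set ℕ+ := {i | max (d v) 1 < d (v ++ [i])}

lemma IsGale.tsum_growthSet_ne_top {s : ℝ≥0} {d : List ℕ+ → ℝ≥0} (hd : IsGale cfMeasure s d)
    (hs : s ≤ 1 / 2) (v : List ℕ+) :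
    ∑' i, (growthSet d v).indicator (fun i : ℕ+ => ((i : ℕ) : ℝ≥0∞)⁻¹) i ≠ ∞ := by
  obtain ⟨c, hc, h⟩ := exists_le_cfMeasure v
  -- Capping at 1 gives `c'/i ≤ 1`, so replacing the exponent `1/2` by a smaller `s` only increases
  -- the power.
  set c' := min c 1
  have hc' : 0 < c' := lt_min hc one_pos
  have key : ∀ i : ℕ+, (growthSet d v).indicator (fun i : ℕ+ => ((i : ℕ) : ℝ≥0∞)⁻¹) i
      ≤ ENNReal.ofReal (1 / c') * ((d (v ++ [i]) : ℝ≥0∞) * cfMeasure (v ++ [i]) ^ (s : ℝ)) := by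
    intro i
    refine indicator_apply_le' (fun hi => ?_) (fun _ => zero_le)
    have hi1 := one_le_pnat_cast i
    have h1 : (1 : ℝ≥0∞) ≤ d (v ++ [i]) := by
      exact_mod_cast ((le_max_right _ _).trans_lt hi).le
    have h2 : ENNReal.ofReal (c' / (i : ℕ)) ≤ cfMeasure (v ++ [i]) ^ (s : ℝ) := by
      have hle : c' / (i : ℕ) ≤ 1 := by
        rw [div_le_one (by positivity)]
        exact (min_le_right _ _).trans hi1
      calc ENNReal.ofReal (c' / (i : ℕ))
          = ENNReal.ofReal (((c' / (i : ℕ)) ^ 2) ^ (1 / 2 : ℝ)) := by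
            rw [← Real.sqrt_eq_rpow, Real.sqrt_sq (by positivity)]
        _ ≤ ENNReal.ofReal (((c' / (i : ℕ)) ^ 2) ^ (s : ℝ)) := by
            refine ENNReal.ofReal_le_ofReal (Real.rpow_le_rpow_of_exponent_ge (by positivity)
              (pow_le_one₀ (by positivity) hle) ?_)
            exact_mod_cast hs
        _ = ENNReal.ofReal ((c' / (i : ℕ)) ^ 2) ^ (s : ℝ) := by
            exact (ENNReal.ofReal_rpow_of_nonneg (by positivity) s.2).symm
        _ ≤ cfMeasure (v ++ [i]) ^ (s : ℝ) := by
            refine ENNReal.rpow_le_rpow (le_trans ?_ (h i)) s.2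
            refine ENNReal.ofReal_le_ofReal (pow_le_pow_left₀ (by positivity) ?_ 2)
            exact div_le_div_of_nonneg_right (min_le_left _ _) (by positivity)
    calc ((i : ℕ) : ℝ≥0∞)⁻¹ = ENNReal.ofReal (1 / c') * (1 * ENNReal.ofReal (c' / (i : ℕ))) := by
          rw [one_mul, ← ENNReal.ofReal_mul (by positivity), one_div_mul_eq_div, div_right_comm,
            div_self hc'.ne', one_div, ENNReal.ofReal_inv_of_pos (by positivity), ENNReal.ofReal_natCast]
      _ ≤ _ := mul_le_mul_right (mul_le_mul' h1 h2) _
  refine ne_top_of_le_ne_top ?_ (ENNReal.tsum_le_tsum key)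
  rw [ENNReal.tsum_mul_left, ← hd v]
  exact ENNReal.mul_ne_top ENNReal.ofReal_ne_top (ENNReal.mul_ne_top ENNReal.coe_ne_top
    (ENNReal.rpow_ne_top_of_nonneg s.2 (cfMeasure_ne_top v)))

lemma tsum_pnat_inv : ∑' i : ℕ+, ((i : ℕ) : ℝ≥0∞)⁻¹ = ∞ := by
  by_contra h
  have h2 : ∀ i : ℕ+, ((i : ℕ) : ℝ≥0∞)⁻¹ = ((((i : ℕ) : ℝ≥0)⁻¹ : ℝ≥0) : ℝ≥0∞) := fun i => by
    rw [ENNReal.coe_inv (by positivity)]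
    simp
  simp_rw [h2] at h
  have h3 := NNReal.summable_coe.2 (ENNReal.tsum_coe_ne_top_iff_summable.1 h)
  push_cast at h3
  have h4 := (Equiv.pnatEquivNat.symm.summable_iff).2 h3
  refine Real.not_summable_natCast_inv ((summable_nat_add_iff 1).1 (h4.congr fun n => ?_))
  simp [Equiv.pnatEquivNat]

/-- Otherwise the `n` sets, together with the finitely many letters below `M`, would cover all
letters and bound the harmonic series. -/
lemma exists_notMem_of_tsum_ne_top {B : ℕ → Set ℕ+}
    (hB : ∀ k, ∑' i, (B k).indicator (fun i : ℕ+ => ((i : ℕ) : ℝ≥0∞)⁻¹) i ≠ ∞) (n M : ℕ) :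
    ∃ i : ℕ+, M ≤ i ∧ ∀ k < n, i ∉ B k := by
  by_contra! hcon
  have hfin : {i : ℕ+ | (i : ℕ) < M}.Finite :=
    (finite_lt_nat M).preimage PNat.coe_injective.injOn
  have key : ∀ i : ℕ+, ((i : ℕ) : ℝ≥0∞)⁻¹ ≤
      ∑ k ∈ Finset.range n, (B k).indicator (fun i : ℕ+ => ((i : ℕ) : ℝ≥0∞)⁻¹) i
        + {i : ℕ+ | (i : ℕ) < M}.indicator 1 i := by
    intro i
    by_cases hi : (i : ℕ) < M
    · refine le_add_left ?_
      rw [indicator_of_mem (by exact hi), Pi.one_apply, ENNReal.inv_le_one]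
      exact_mod_cast i.pos
    · obtain ⟨k, hk, hik⟩ := hcon i (not_lt.1 hi)
      refine le_add_right ?_
      refine le_trans ?_ (Finset.single_le_sum (fun _ _ => zero_le) (Finset.mem_range.2 hk))
      rw [indicator_of_mem hik]
  have h := ENNReal.tsum_le_tsum key
  rw [tsum_pnat_inv, ENNReal.tsum_add, Summable.tsum_finsetSum fun _ _ => ENNReal.summable,
    top_le_iff, ENNReal.add_eq_top] at h
  rcases h with h | h
  · exact ENNReal.sum_ne_top.2 (fun k _ => hB k) h
  · rw [← tsum_subtype] at h
    have := hfin.fintype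
    rw [tsum_fintype] at h
    simp at h

/-! ### Countability of the lower semicomputable functions -/

lemma countable_setOf_computable (α : Type) [Primcodable α] :
    {f : α → ℕ | Computable f}.Countable := by
  have h : ∀ f : {f : α → ℕ | Computable f}, ∃ c : Nat.Partrec.Code,
      c.eval = fun n => Part.bind (Encodable.decode (α := α) n) fun a => Part.some (f.1 a) := by
    intro f
    have := Nat.Partrec.Code.exists_code.1 f.2
    simpa using! this
  choose c hc using h
  refine Function.Injective.countable (f := c) fun f g hfg => Subtype.ext (funext fun a => ?_)
  have h1 := congrFun ((hc f).symm.trans (hfg ▸ hc g)) (Encodable.encode a)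
  simpa using h1

/-- Such a function is the limit of its approximations, hence determined by their computable
numerators and denominators. -/
lemma countable_setOf_lowerSemicomputable (α : Type) [Primcodable α] :
    {d : α → ℝ≥0 | LowerSemicomputable d}.Countable := by
  have hc := countable_setOf_computable (α × ℕ)
  have h : ∀ d : {d : α → ℝ≥0 | LowerSemicomputable d},
      ∃ p : {f : α × ℕ → ℕ | Computable f} × {f : α × ℕ → ℕ | Computable f}, ∀ w,
        Tendsto (fun n : ℕ => ((((p.1.1 (w, n) : ℚ≥0) / (p.2.1 (w, n) : ℚ≥0)) : ℚ≥0) : ℝ≥0)) atTop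
          (𝓝 (d.1 w)) := by
    rintro ⟨d, dhat, ⟨num, den, hnum, hden, heq⟩, -, hlim⟩
    refine ⟨⟨⟨num, hnum⟩, ⟨den, hden⟩⟩, fun w => (hlim w).congr fun n => ?_⟩
    rw [(heq (w, n)).2]
  choose p hp using h
  have := hc.to_subtype
  refine Function.Injective.countable (f := p) fun d e hde => Subtype.ext (funext fun w => ?_)
  have h1 := hp e w
  rw [← hde] at h1
  exact tendsto_nhds_unique (hp d w) h1

/-! ### A rapidly growing sequence defeating all gales -/

lemma isGale_zero (s : ℝ≥0) : IsGale cfMeasure s 0 := fun w => by simp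

/-- For every growth condition `M` there is a sequence satisfying it on which no lower semicomputable
gale of exponent at most `1 / 2` succeeds. -/
theorem exists_sequence_defeating_gales (M : List ℕ+ → ℕ) :
    ∃ Y : ℕ → ℕ+, (∀ n, M (pre Y n) ≤ Y n) ∧
      ∀ (s : ℝ≥0) (d : List ℕ+ → ℝ≥0), s ≤ 1 / 2 → IsGale cfMeasure s d →
        LowerSemicomputable d → Y ∉ successSet d := by
  -- The zero gale is added so that the family is nonempty and can be enumerated.
  set D : Set (List ℕ+ → ℝ≥0) :=
    insert 0 ({d | LowerSemicomputable d} ∩ {d | ∃ s : ℝ≥0, s ≤ 1 / 2 ∧ IsGale cfMeasure s d})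
  have hDc : D.Countable :=
    ((countable_setOf_lowerSemicomputable (List ℕ+)).mono inter_subset_left).insert 0
  obtain ⟨e, he⟩ := hDc.exists_eq_range ⟨0, mem_insert _ _⟩
  have hgale : ∀ k, ∃ s : ℝ≥0, s ≤ 1 / 2 ∧ IsGale cfMeasure s (e k) := by
    intro k
    have hk : e k ∈ D := he ▸ mem_range_self k
    rcases hk with hk | hk
    · exact ⟨0, by simp, hk ▸ isGale_zero 0⟩
    · exact hk.2
  have hstep : ∀ v : List ℕ+, ∃ i : ℕ+, M v ≤ i ∧ ∀ k < v.length, i ∉ growthSet (e k) v := by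
    intro v
    refine exists_notMem_of_tsum_ne_top (fun k => ?_) _ _
    obtain ⟨s, hs, hg⟩ := hgale k
    exact hg.tsum_growthSet_ne_top hs v
  choose nxt hM hgood using hstep
  let W : ℕ → List ℕ+ := fun n => Nat.rec [] (fun _ v => v ++ [nxt v]) n
  let Y : ℕ → ℕ+ := fun n => nxt (W n)
  have hW : ∀ n, pre Y n = W n := by
    intro n
    induction n with
    | zero => rfl
    | succ n ih => rw [pre_succ, ih]
  refine ⟨Y, fun n => ?_, fun s d hs hd hl hY => ?_⟩
  · rw [hW]
    exact hM _
  · have hdD : d ∈ D := mem_insert_of_mem _ ⟨hl, s, hs, hd⟩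
    rw [he] at hdD
    obtain ⟨k, rfl⟩ := hdD
    -- Gale `k` is guarded against only at words longer than `k`; from then on it cannot exceed the
    -- larger of 1 and its value there.
    have hle : ∀ n, k + 1 ≤ n → e k (pre Y n) ≤ max (e k (pre Y (k + 1))) 1 := by
      intro n hn
      induction n, hn using Nat.le_induction with
      | base => exact le_max_left _ _
      | succ n hn ih =>
        have h1 := hgood (pre Y n) k (by simpa using hn)
        have h2 : nxt (pre Y n) = Y n := by rw [hW]
        rw [h2, growthSet, mem_ofPred_eq, not_lt, ← pre_succ] at h1
        exact h1.trans (max_le ih (le_max_right _ _))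
    have hlim : limsup (fun n : ℕ => (e k (pre Y n) : ℝ≥0∞)) atTop
        ≤ (max (e k (pre Y (k + 1))) 1 : ℝ≥0) := by
      refine limsup_le_of_le (by isBoundedDefault) ?_
      filter_upwards [eventually_ge_atTop (k + 1)] with n hn
      exact_mod_cast hle n hn
    rw [show limsup (fun n : ℕ => (e k (pre Y n) : ℝ≥0∞)) atTop = ∞ from hY, top_le_iff] at hlim
    exact ENNReal.coe_ne_top hlim

/-! ### Binary cylinders -/

/-- The digits of `w` contribute a constant `S`, and the free tail, scaled by `2^{-l}`, covers all
of `[0,1]`. -/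
lemma binMeasure_eq (w : List (Fin 2)) : binMeasure w = ((2 : ℝ≥0∞) ^ w.length)⁻¹ := by
  set l := w.length with hl
  set Z : ℕ → Fin 2 := fun i => w.getD i 0 with hZ
  have hZw : pre Z l = w := by
    refine List.ext_getElem (by simp [hl]) fun i h1 h2 => ?_
    simp [pre, hZ, List.getElem?_eq_getElem h2]
  set S : ℝ := ∑ i ∈ Finset.range l, Real.ofDigitsTerm Z i
  have hsum : ∀ Y : ℕ → Fin 2, pre Y l = w →
      ∑ i ∈ Finset.range l, Real.ofDigitsTerm Y i = S := by
    intro Y hY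
    refine Finset.sum_congr rfl fun i hi => ?_
    have h := hY.trans hZw.symm
    simp only [pre, List.map_inj_left, List.mem_range] at h
    rw [Real.ofDigitsTerm, Real.ofDigitsTerm, h i (Finset.mem_range.1 hi)]
  have himg : Real.ofDigits '' cylinder w = Icc S (S + ((2 : ℝ) ^ l)⁻¹) := by
    have hpos : (0 : ℝ) < 2 ^ l := by positivity
    ext x
    constructor
    · rintro ⟨Y, hY, rfl⟩
      rw [Real.ofDigits_eq_sum_add_ofDigits Y l, hsum Y hY]
      have h0 := Real.ofDigits_nonneg fun i => Y (i + l)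
      have h1 := Real.ofDigits_le_one fun i => Y (i + l)
      push_cast
      refine ⟨le_add_of_nonneg_right (by positivity), add_le_add_right ?_ _⟩
      exact mul_le_of_le_one_right (by positivity) h1
    · rintro ⟨h0, h1⟩
      obtain ⟨U, -, hU⟩ := Real.ofDigits_SurjOn one_lt_two
        (show 2 ^ l * (x - S) ∈ Icc (0 : ℝ) 1 from
          ⟨mul_nonneg hpos.le (by linarith), by
            rw [← le_div_iff₀' hpos, one_div]
            linarith⟩)
      set Y : ℕ → Fin 2 := fun i => if i < l then Z i else U (i - l) with hYdef
      have hY : pre Y l = w := by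
        rw [← hZw]
        exact pre_congr fun i hi => if_pos hi
      refine ⟨Y, hY, ?_⟩
      have htail : (fun i => Y (i + l)) = U := by
        funext i
        simp [hYdef]
      rw [Real.ofDigits_eq_sum_add_ofDigits Y l, hsum Y hY, htail, hU]
      push_cast
      rw [inv_mul_cancel_left₀ hpos.ne']
      ring
  rw [binMeasure, himg, Real.volume_Icc, add_sub_cancel_left, ENNReal.ofReal_inv_of_pos
    (by positivity), ENNReal.ofReal_pow (by norm_num), ENNReal.ofReal_ofNat]

/-! ### The gale that bets on an enumerated family of sequences -/

section MixtureGale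

variable (T : ℕ → ℕ → Fin 2)

/-- The weight `2 ^ -(c + 1)` if the sequence `T c` begins with `w`, and `0` otherwise. -/
def prefixWeight (K : Type*) [Semifield K] (w : List (Fin 2)) (c : ℕ) : K :=
  if pre (T c) w.length = w then (1 / 2) ^ (c + 1) else 0

lemma prefixWeight_add (K : Type*) [Semifield K] (w : List (Fin 2)) (c : ℕ) :
    prefixWeight T K w c = prefixWeight T K (w ++ [0]) c + prefixWeight T K (w ++ [1]) c := by
  simp only [prefixWeight, List.length_append, List.length_singleton, pre_succ]
  have key : ∀ b : Fin 2, pre (T c) w.length ++ [T c w.length] = w ++ [b] ↔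
      pre (T c) w.length = w ∧ T c w.length = b := fun b => by
    refine ⟨fun h => ?_, fun h => by rw [h.1, h.2]⟩
    simpa using List.append_inj h (by simp)
  simp only [key]
  by_cases h : pre (T c) w.length = w
  · have : T c w.length = 0 ∨ T c w.length = 1 := by
      generalize T c w.length = b
      fin_cases b <;> simp
    rcases this with h1 | h1 <;> simp [h, h1]
  · simp [h]

lemma summable_prefixWeight (w : List (Fin 2)) : Summable (prefixWeight T ℝ≥0 w) := by
  have h2 : (1 / 2 : ℝ≥0) < 1 := by
    rw [← NNReal.coe_lt_coe]
    norm_num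
  have h : Summable fun c : ℕ => (1 / 2 : ℝ≥0) ^ (c + 1) := by
    simpa only [pow_succ] using (NNReal.summable_geometric h2).mul_right (1 / 2)
  refine NNReal.summable_of_le (fun c => ?_) h
  rw [prefixWeight]
  split_ifs
  · exact le_rfl
  · exact zero_le

/-- The gale with stake growth `r` per digit that bets on the sequences `T c`. -/
noncomputable def mixtureGale (r : ℝ≥0) (w : List (Fin 2)) : ℝ≥0 :=
  r ^ w.length * ∑' c, prefixWeight T ℝ≥0 w c

/-- As `r = 2^s`, the factor `r^|w|` cancels `μ(C_w)^s`, leaving the additive total weight of the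
sequences through `w`. -/
lemma isGale_mixtureGale {r s : ℝ≥0} (hr : 0 < r) (hs : (2 : ℝ) ^ (s : ℝ) = r) :
    IsGale binMeasure s (mixtureGale T r) := by
  have hm : ∀ w : List (Fin 2), (mixtureGale T r w : ℝ≥0∞) * binMeasure w ^ (s : ℝ)
      = ((∑' c, prefixWeight T ℝ≥0 w c : ℝ≥0) : ℝ≥0∞) := by
    intro w
    have h2 : (2 : ℝ≥0∞) ^ (s : ℝ) = r := by
      have h3 : (2 : ℝ≥0) ^ (s : ℝ) = r := by
        rw [← NNReal.coe_inj, NNReal.coe_rpow]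
        exact_mod_cast hs
      rw [← h3]
      exact (ENNReal.coe_rpow_of_nonneg 2 s.coe_nonneg).symm
    rw [binMeasure_eq, ENNReal.inv_rpow, ← ENNReal.rpow_natCast, ← ENNReal.rpow_mul, mul_comm (_ : ℝ),
      ENNReal.rpow_mul, h2, ENNReal.rpow_natCast, mixtureGale, ENNReal.coe_mul, ENNReal.coe_pow,
      mul_comm, ← mul_assoc, ENNReal.inv_mul_cancel (by simp [hr.ne'])
      (ENNReal.pow_ne_top ENNReal.coe_ne_top), one_mul]
  intro w
  rw [hm, tsum_fintype (L := .unconditional (Fin 2)), Fin.sum_univ_two, hm, hm, ← ENNReal.coe_add,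
    ← (summable_prefixWeight T _).tsum_add (summable_prefixWeight T _)]
  congr 2
  exact funext (prefixWeight_add T ℝ≥0 w)

/-- The numerator of the sum of the first `n` weights over the denominator `2 ^ n`. -/
def weightNumerator (w : List (Fin 2)) (n : ℕ) : ℕ :=
  Nat.rec 0 (fun c acc => 2 * acc + if pre (T c) w.length = w then 1 else 0) n

lemma sum_prefixWeight_eq (w : List (Fin 2)) (n : ℕ) :
    ∑ c ∈ Finset.range n, prefixWeight T ℚ≥0 w c = (weightNumerator T w n : ℚ≥0) / 2 ^ n := by
  induction n with
  | zero => simp [weightNumerator]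
  | succ n ih =>
    have h : weightNumerator T w (n + 1)
      = 2 * weightNumerator T w n + if pre (T n) w.length = w then 1 else 0 := rfl
    rw [Finset.sum_range_succ, ih, h, prefixWeight]
    split_ifs
    · push_cast
      simp only [div_pow, one_pow]
      field_simp
      ring
    · push_cast
      field_simp
      ring

lemma primrec_weightNumerator {T : ℕ → ℕ → Fin 2} (hT : Primrec₂ T) :
    Primrec₂ (weightNumerator T) := by
  have hpre : Primrec₂ fun (w : List (Fin 2)) (c : ℕ) => pre (T c) w.length :=
    Primrec.list_map (Primrec.list_range.comp (Primrec.list_length.comp Primrec.fst))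
      (hT.comp (Primrec.snd.comp Primrec.fst) Primrec.snd)
  have hstep : Primrec₂ fun (w : List (Fin 2)) (p : ℕ × ℕ) =>
      2 * p.2 + if pre (T p.1) w.length = w then 1 else 0 := by
    refine Primrec.nat_add.comp (Primrec.nat_mul.comp (Primrec.const 2)
      (Primrec.snd.comp Primrec.snd)) (Primrec.ite ?_ (Primrec.const 1) (Primrec.const 0))
    exact Primrec.eq.comp (hpre.comp Primrec.fst (Primrec.fst.comp Primrec.snd)) Primrec.fst
  exact Primrec.nat_rec (Primrec.const 0) hstep

lemma primrec_pow : Primrec₂ ((· ^ ·) : ℕ → ℕ → ℕ) :=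
  Primrec₂.unpaired'.1 Nat.Primrec.pow

lemma lowerSemicomputable_mixtureGale {T : ℕ → ℕ → Fin 2} (hT : Primrec₂ T) {k : ℕ} (hk : 0 < k) :
    LowerSemicomputable (mixtureGale T ((k + 1) / k)) := by
  have hk' : (k : ℝ≥0) ≠ 0 := by exact_mod_cast hk.ne'
  refine ⟨fun p => (((k + 1) / k : ℚ≥0)) ^ p.1.length
    * ∑ c ∈ Finset.range p.2, prefixWeight T ℚ≥0 p.1 c, ?_, ?_, ?_⟩
  · refine ⟨fun p => (k + 1) ^ p.1.length * weightNumerator T p.1 p.2,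
      fun p => k ^ p.1.length * 2 ^ p.2, Primrec.to_comp ?_, Primrec.to_comp ?_, fun p => ⟨?_, ?_⟩⟩
    · exact Primrec.nat_mul.comp (primrec_pow.comp (Primrec.const _)
        (Primrec.list_length.comp Primrec.fst)) (primrec_weightNumerator hT)
    · exact Primrec.nat_mul.comp (primrec_pow.comp (Primrec.const _)
        (Primrec.list_length.comp Primrec.fst)) (primrec_pow.comp (Primrec.const _) Primrec.snd)
    · positivity
    · simp only []
      rw [sum_prefixWeight_eq, div_pow, div_mul_div_comm]
      push_cast
      rfl
  all_goals
    have hcast : ∀ w n, ((((((k + 1) / k : ℚ≥0)) ^ w.length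
        * ∑ c ∈ Finset.range n, prefixWeight T ℚ≥0 w c : ℚ≥0)) : ℝ≥0)
        = ((k + 1) / k) ^ w.length * ∑ c ∈ Finset.range n, prefixWeight T ℝ≥0 w c := by
      intro w n
      push_cast
      congr 1
      refine Finset.sum_congr rfl fun c _ => ?_
      simp only [prefixWeight]
      split_ifs <;> simp
  · intro w n
    refine ⟨mul_le_mul_right (Finset.sum_le_sum_of_subset (by simp)) _, ?_⟩
    rw [hcast]
    exact mul_le_mul_right ((summable_prefixWeight T w).sum_le_tsum _ fun _ _ => zero_le) _
  · intro w
    simp only [hcast]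
    exact (summable_prefixWeight T w).hasSum.tendsto_sum_nat.const_mul _

/-- The single summand `c` already guarantees capital `r^L 2^{-(c+1)}` at length `L`. -/
lemma mem_successSet_mixtureGale {r : ℝ≥0} {X : ℕ → Fin 2}
    (h : ∀ m : ℕ, ∃ L c : ℕ, m ≤ L ∧ pre X L = pre (T c) L ∧
      (m : ℝ≥0) ≤ r ^ L * (1 / 2) ^ (c + 1)) :
    X ∈ successSet (mixtureGale T r) := by
  refine ENNReal.eq_top_of_forall_nnreal_le fun x => ?_
  refine le_limsup_of_frequently_le (frequently_atTop.2 fun N => ?_) (by isBoundedDefault)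
  obtain ⟨m, hm⟩ := exists_nat_ge x
  obtain ⟨L, c, hL, hpre, hle⟩ := h (max m N)
  refine ⟨L, (le_max_right _ _).trans hL, ENNReal.coe_le_coe.2 ?_⟩
  have h1 : x ≤ ((max m N : ℕ) : ℝ≥0) := hm.trans (by exact_mod_cast le_max_left m N)
  refine (h1.trans hle).trans ?_
  rw [mixtureGale, length_pre]
  refine mul_le_mul_right ?_ _
  refine le_trans (le_of_eq ?_) ((summable_prefixWeight T _).le_tsum c fun _ _ => zero_le)
  rw [prefixWeight, length_pre, if_pos hpre.symm]

end MixtureGale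

/-! ### Binary digits of rational numbers -/

/-- The binary digits of the fractional part of `a / b`, where `c` is the code of `(a, b)`. -/
def ratDigits (c i : ℕ) : Fin 2 := Fin.ofNat 2 (c.unpair.1 * 2 ^ (i + 1) / c.unpair.2)

lemma primrec_ratDigits : Primrec₂ ratDigits := by
  refine Primrec.fin_val_iff.1 ?_
  refine Primrec.nat_mod.comp (Primrec.nat_div.comp (Primrec.nat_mul.comp ?_ ?_) ?_)
    (Primrec.const 2)
  · exact Primrec.fst.comp (Primrec.unpair.comp Primrec.fst)
  · exact primrec_pow.comp (Primrec.const 2) (Primrec.succ.comp Primrec.snd)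
  · exact Primrec.snd.comp (Primrec.unpair.comp Primrec.fst)

/-- For `i < L`, the multiple `a 2^(i+1) / b` of `1/b` lies at least `1/b` below the next integer
above its floor, while passing to `x` adds less than `1/b`; so the floors agree. -/
lemma pre_digits_eq_pre_ratDigits {x : ℝ} {a b L : ℕ} (hb : 0 < b) (h1 : (a : ℝ) / b ≤ x)
    (h2 : x < a / b + 1 / (2 ^ L * b)) :
    pre (Real.digits x 2) L = pre (ratDigits (Nat.pair a b)) L := by
  refine pre_congr fun i hi => ?_
  rw [Real.digits, ratDigits, Nat.unpair_pair]
  congr 1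
  have hb' : (0 : ℝ) < b := by exact_mod_cast hb
  set q := a * 2 ^ (i + 1) / b with hq
  have hq1 : (q * b : ℝ) ≤ a * 2 ^ (i + 1) := by
    exact_mod_cast Nat.div_mul_le_self _ _
  have hq2 : (a * 2 ^ (i + 1) + 1 : ℝ) ≤ (q + 1) * b := by
    have := Nat.lt_mul_div_succ (a * 2 ^ (i + 1)) hb
    have : a * 2 ^ (i + 1) + 1 ≤ (q + 1) * b := by
      rw [hq, mul_comm (_ + 1) b]
      exact this
    exact_mod_cast this
  have hx : (0 : ℝ) ≤ x := le_trans (by positivity) h1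
  have hpow : (2 : ℝ) ^ (i + 1) ≤ 2 ^ L := pow_le_pow_right₀ one_le_two hi
  rw [Nat.floor_eq_iff (by positivity)]
  push_cast
  constructor
  · calc (q : ℝ) ≤ a * 2 ^ (i + 1) / b := by rwa [le_div_iff₀ hb']
      _ = a / b * 2 ^ (i + 1) := by ring
      _ ≤ x * 2 ^ (i + 1) := mul_le_mul_of_nonneg_right h1 (by positivity)
  · calc x * 2 ^ (i + 1) < (a / b + 1 / (2 ^ L * b)) * 2 ^ (i + 1) :=
          mul_lt_mul_of_pos_right h2 (by positivity)
      _ = (a * 2 ^ (i + 1) + 2 ^ (i + 1) / 2 ^ L) / b := by field_simp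
      _ ≤ (a * 2 ^ (i + 1) + 1) / b := by
          refine div_le_div_of_nonneg_right (add_le_add_right ?_ _) hb'.le
          rwa [div_le_one (by positivity)]
      _ ≤ q + 1 := by rwa [div_le_iff₀ hb']

/-- Rapid growth of the partial quotients forces small constructive dimension. -/
lemma exists_growth_cdim_le {r s : ℝ≥0} {k : ℕ} (hk : 0 < k) (hr : r = (k + 1) / k)
    (hs : (2 : ℝ) ^ (s : ℝ) = r) :
    ∃ M : List ℕ+ → ℕ, ∀ Y : ℕ → ℕ+, (∀ n, M (pre Y n) ≤ Y n) → cdim Y ≤ s := by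
  choose a b hb hab using cfMap_zero_rat
  have hk' : (0 : ℝ≥0) < k := by exact_mod_cast hk
  have hr1 : 1 < r := by
    rw [hr, lt_div_iff₀ hk', one_mul]
    exact lt_add_one _
  -- `L v` digits suffice to outgrow the initial stake on the convergent. Neither `L` nor `M` has to
  -- be computable: only the enumeration of rationals enters the gale.
  have hL : ∀ v : List ℕ+, ∃ L : ℕ, v.length ≤ L ∧
      (v.length : ℝ≥0) ≤ r ^ L * (1 / 2) ^ (Nat.pair (a v) (b v) + 1) := by
    intro v
    have h1 : Tendsto (fun L : ℕ => r ^ L * (1 / 2) ^ (Nat.pair (a v) (b v) + 1)) atTop atTop :=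
      (tendsto_pow_atTop_atTop_of_one_lt hr1).atTop_mul_const (by positivity)
    exact ((eventually_ge_atTop v.length).and (h1.eventually_ge_atTop _)).exists
  choose L hL1 hL2 using hL
  refine ⟨fun v => 2 ^ L v * b v, fun Y hY => sInf_le ⟨s, rfl, mixtureGale ratDigits r,
    isGale_mixtureGale _ (one_pos.trans hr1) hs, ?_, ?_⟩⟩
  · rw [hr]
    exact lowerSemicomputable_mixtureGale primrec_ratDigits hk
  · refine singleton_subset_iff.2 (mem_successSet_mixtureGale _ fun m => ?_)
    -- Even length puts the convergent below `x`, as the comparison of digits requires.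
    set v := pre Y (2 * m) with hv
    have hlen : v.length = 2 * m := length_pre _ _
    have hm : m ≤ v.length := by omega
    refine ⟨L v, Nat.pair (a v) (b v), hm.trans (hL1 v), ?_, le_trans ?_ (hL2 v)⟩
    · have hY' := hY (2 * m)
      set t := cfValue fun n => Y (n + 2 * m) with ht
      have hx : cfValue Y = cfMap v t := cfValue_eq_cfMap _ _
      obtain ⟨h1, h2⟩ := cfMap_sub_of_even v (by simp [hlen])
        (t := t) ⟨cfValue_pos _, (cfValue_lt_one _).le⟩
      have h3 : t < 1 / ((Y (2 * m) : ℕ) : ℝ) := by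
        simpa using cfValue_lt_one_div fun n => Y (n + 2 * m)
      have hb' : (0 : ℝ) < b v := by exact_mod_cast hb v
      have h4 : 1 / ((Y (2 * m) : ℕ) : ℝ) ≤ 1 / (2 ^ L v * b v) :=
        one_div_le_one_div_of_le (by positivity) (by exact_mod_cast hY')
      rw [hab] at h1 h2
      exact pre_digits_eq_pre_ratDigits (hb v) (by linarith) (by linarith)
    · exact_mod_cast hm

end CFDim

theorem mainTheorem5 (ε : ℝ) (hε : 0 < ε) (hε' : ε < 1 / 2) :
    ∃ Y : ℕ → ℕ+, (1 / 2 : ℝ≥0∞) ≤ CFDim.cdimCF Y ∧ CFDim.cdim Y ≤ ENNReal.ofReal ε := by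
  have hlog := Real.log_pos one_lt_two
  -- Chosen so that `log₂(1 + 1/k) ≤ 1/(k log 2) < ε`.
  obtain ⟨k, hk⟩ := exists_nat_gt (1 / (ε * Real.log 2))
  have hk0 : (0 : ℝ) < k := lt_trans (by positivity) hk
  have hr : (1 : ℝ) ≤ (k + 1) / k := by
    rw [le_div_iff₀ hk0]
    linarith
  have hs0 : 0 ≤ Real.logb 2 ((k + 1) / k) := Real.logb_nonneg one_lt_two hr
  obtain ⟨M, hM⟩ := CFDim.exists_growth_cdim_le (r := ((k : ℝ≥0) + 1) / k)
    (s := (Real.logb 2 ((k + 1) / k)).toNNReal) (k := k) (by exact_mod_cast hk0) rfl (by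
      rw [Real.coe_toNNReal _ hs0]
      push_cast
      exact Real.rpow_logb two_pos (by norm_num) (by positivity))
  obtain ⟨Y, hY, hYd⟩ := CFDim.exists_sequence_defeating_gales M
  refine ⟨Y, ?_, (hM Y hY).trans ?_⟩
  · refine le_sInf ?_
    rintro _ ⟨s, rfl, d, hd, hl, hsub⟩
    by_contra! hlt
    refine hYd s d ?_ hd hl (hsub rfl)
    have h1 : (s : ℝ≥0∞) ≤ ((1 / 2 : ℝ≥0) : ℝ≥0∞) := by
      rw [ENNReal.coe_div two_ne_zero, ENNReal.coe_one, ENNReal.coe_ofNat]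
      exact hlt.le
    exact ENNReal.coe_le_coe.1 h1
  · refine ENNReal.ofReal_le_ofReal ?_
    have h1 : Real.log ((k + 1) / k) ≤ 1 / k := by
      refine (Real.log_le_sub_one_of_pos (by positivity)).trans (le_of_eq ?_)
      field_simp
      ring
    rw [Real.logb, div_le_iff₀ hlog]
    refine h1.trans ?_
    rw [div_lt_iff₀ (by positivity)] at hk
    rw [div_le_iff₀ hk0]
    linarith
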